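/- Let $d\ge 0$ be an integer, let $\lambda$ be Lebesgue measure on $\mathbb R^d$ (with the Euclidean norm), and for a sequence of sets write $\limsup A_i=\bigcap_{n}\bigcup_{i\ge n}A_i$. For $E\subset\mathbb R^d$ and $t\ge 0$ define the generalized singular value function $$\varphi^t(E)=\sup_\mu\ \inf_{x\in E}\ \inf_{r>0}\ \frac{r^t}{\mu(B_r(x))}\in[0,\infty],$$ where the supremum is over Borel probability measures $\mu$ with $\mu(\mathbb R^d\setminus E)=0$, $B_r(x)$ is the closed ball of radius $r$ and centre $x$, and $r^t/0=\infty$. Let $(B_i)$ be a sequence of balls (each open or closed, of positive radius) contained in $[0,1]^d$, whose radii tend to $0$, such that $\lambda(\limsup B_i)=1$. Let $(E_i)$ be a sequence of nonempty open sets with $E_i\subset B_i$. Define $$s=\sup\{t\ge 0 : \lambda(\limsup\{B_i : \varphi^t(E_i)\ge\lambda(B_i)\})=1\},$$ where the inner limsup is the set of points lying in $B_i$ for infinitely many of the indices $i$ with $\varphi^t(E_i)\ge\lambda(B_i)$. Then $$\dim_{\mathcal H}\limsup E_i\ge s\qquad\text{and}\qquad \dim_{\mathcal P}\limsup E_i=d,$$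 where $\dim_{\mathcal H}$ and $\dim_{\mathcal P}$ denote Hausdorff and packing dimension. -/

import Mathlib

open Set Filter Topology MeasureTheory Metric
open scoped NNReal ENNReal

noncomputable section

/-- The unit cube `[0,1]^d` in Euclidean space. -/
def unitCube (d : ℕ) : Set (EuclideanSpace ℝ (Fin d)) :=
  {x | ∀ j, x j ∈ Icc (0 : ℝ) 1}

/-- The generalized singular value function
`φ^t(E) = sup_μ inf_{x ∈ E} inf_{r > 0} r^t / μ(B_r(x))`, the supremum being over the Borel
probability measures supported on `E`. It takes values in `[0,∞]`; a ball of measure zero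
contributes `r^t / 0 = ∞` to the infimum. -/
def singularValue {d : ℕ} (t : ℝ) (E : Set (EuclideanSpace ℝ (Fin d))) : ℝ≥0∞ :=
  ⨆ (μ : Measure (EuclideanSpace ℝ (Fin d))) (_ : IsProbabilityMeasure μ ∧ μ Eᶜ = 0),
    ⨅ (x ∈ E) (r : ℝ) (_ : 0 < r), ENNReal.ofReal (r ^ t) / μ (closedBall x r)

section Packing

variable {X : Type*} [MetricSpace X]

/-- A finite `δ`-packing of `F`: pairs (centre, radius) with centres in `F` and radii in `(0, δ]`
whose closed balls are pairwise disjoint. -/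
def IsBallPacking (F : Set X) (δ : ℝ) (P : Finset (X × ℝ)) : Prop :=
  (∀ p ∈ P, p.1 ∈ F ∧ 0 < p.2 ∧ p.2 ≤ δ) ∧
    (P : Set (X × ℝ)).PairwiseDisjoint fun p => closedBall p.1 p.2

/-- `P^s_δ(F)`: the supremum of `∑ (2 r_i)^s` over `δ`-packings of `F`. The terms are nonnegative,
so finite packings give the same supremum as countable ones. -/
def packingSum (s : ℝ≥0) (δ : ℝ) (F : Set X) : ℝ≥0∞ :=
  ⨆ (P : Finset (X × ℝ)) (_ : IsBallPacking F δ P), ∑ p ∈ P, ENNReal.ofReal ((2 * p.2) ^ (s : ℝ))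

/-- The packing premeasure `P^s_0(F) = lim_{δ → 0} P^s_δ(F)`; the quantity decreases with `δ`, so
the limit is an infimum. -/
def packingPremeasure (s : ℝ≥0) (F : Set X) : ℝ≥0∞ :=
  ⨅ (δ : ℝ) (_ : 0 < δ), packingSum s δ F

/-- The `s`-dimensional packing measure
`P^s(F) = inf {∑ P^s_0(A_n) : F ⊆ ⋃ A_n}` (countable covers). -/
def packingMeasure (s : ℝ≥0) (F : Set X) : ℝ≥0∞ :=
  ⨅ (A : ℕ → Set X) (_ : F ⊆ ⋃ n, A n), ∑' n, packingPremeasure s (A n)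

/-- The packing dimension `sup {s ≥ 0 : P^s(F) = ∞}`. -/
def packingDim (F : Set X) : ℝ≥0∞ :=
  ⨆ (s : ℝ≥0) (_ : packingMeasure s F = ∞), (s : ℝ≥0∞)

end Packing

/-- `sup {t ≥ 0 : λ(limsup {B_i : φ^t(E_i) ≥ λ(B_i)}) = 1}`. The `i`-th set below is `B i` if
`φ^t(E_i) ≥ λ(B_i)` and is empty otherwise, so its limsup is that of the selected balls. -/
def transferExponent {d : ℕ} (B E : ℕ → Set (EuclideanSpace ℝ (Fin d))) : ℝ≥0∞ :=
  ⨆ (t : ℝ≥0)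
    (_ : volume (limsup (fun i => {x ∈ B i | volume (B i) ≤ singularValue t (E i)}) atTop) = 1),
    (t : ℝ≥0∞)

end

/-! Hausdorff bound: fix an admissible `t` and `u < t`. A Frostman measure of exponent `t` exists on
some `E_i`, so `t ≤ d` and `u < d`. Starting from Lebesgue measure on one ball, mass is pushed
repeatedly into sets `E_i` of ever later index. Given `ν` on an open `U` with density at most `M`
and `ν (B_s) ≤ C s^u`, a Vitali argument finds finitely many disjoint small selected balls in `U`
carrying almost all of `ν`. The mass of each such ball is moved onto `E_i` along a measure `μ_i`
with `λ(B_i) μ_i(B_s) ≤ A s^t`, which the singular value condition provides.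

At small scales the new measure of `B_s` is `O(s^d + s^t)`, hence below `C' s^u`. At larger scales
mass has moved so little that `C` worsens only to a prescribed `C' > C`
(`IsFrostmanOn.exists_refinement`). Mollifying each `μ_i` keeps the density bounded, so the step can
be iterated. The nested compact closures meet inside `limsup E_i`. Since constants and masses stay
uniformly bounded, the mass distribution principle applies to the intersection without a limit
measure (`hausdorffMeasure_iInter_ne_zero`).

Packing dimension: `limsup E_i` is a Gδ set dense in a ball. By Baire, every countable cover of it
has a member dense in some ball, and such a member has infinite packing premeasure for every
exponent below `d`. -/

/-! ### Volumes of balls and of the unit cube -/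

section Volume

variable {d : ℕ}

theorem volume_closedBall_eq (x : EuclideanSpace ℝ (Fin d)) {r : ℝ} (hr : 0 ≤ r) :
    volume (closedBall x r) =
      ENNReal.ofReal (r ^ d) * volume (ball (0 : EuclideanSpace ℝ (Fin d)) 1) := by
  simpa using Measure.addHaar_closedBall volume x hr

theorem volume_unitBall_ne_zero : volume (ball (0 : EuclideanSpace ℝ (Fin d)) 1) ≠ 0 :=
  (measure_ball_pos volume _ one_pos).ne'

theorem volume_unitBall_ne_top : volume (ball (0 : EuclideanSpace ℝ (Fin d)) 1) ≠ ∞ :=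
  measure_ball_lt_top.ne

theorem volume_closedBall_mul (x y : EuclideanSpace ℝ (Fin d)) {a r : ℝ} (ha : 0 ≤ a)
    (hr : 0 ≤ r) :
    volume (closedBall x (a * r)) = ENNReal.ofReal (a ^ d) * volume (closedBall y r) := by
  rw [volume_closedBall_eq x (mul_nonneg ha hr), volume_closedBall_eq y hr, mul_pow,
    ENNReal.ofReal_mul (by positivity), mul_assoc]

theorem isBounded_unitCube : Bornology.IsBounded (unitCube d) := by
  refine (Metric.isBounded_closedBall (x := (0 : EuclideanSpace ℝ (Fin d)))
    (r := Real.sqrt d)).subset fun x hx => ?_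
  rw [mem_closedBall_zero_iff, EuclideanSpace.norm_eq]
  refine Real.sqrt_le_sqrt ?_
  calc ∑ i, ‖x i‖ ^ 2 ≤ ∑ _i : Fin d, (1 : ℝ) := by
        refine Finset.sum_le_sum fun i _ => ?_
        have := hx i
        rw [Real.norm_eq_abs, sq_abs]
        nlinarith [this.1, this.2]
    _ = d := by simp

theorem volume_unitCube : volume (unitCube d) = 1 := by
  have hpre : unitCube d = (MeasurableEquiv.toLp 2 (Fin d → ℝ)).symm ⁻¹'
      (Icc (0 : Fin d → ℝ) 1) := by
    ext x
    simp [unitCube, Pi.le_def, forall_and]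
  rw [hpre, (EuclideanSpace.volume_preserving_symm_measurableEquiv_toLp (Fin d)).measure_preimage
    measurableSet_Icc.nullMeasurableSet, Real.volume_Icc_pi]
  simp

end Volume

/-! ### Packing dimension: upper bound and Baire category -/

section PackingDimension

variable {d : ℕ}

/-- Disjoint balls of radius at most 1 lie in the 1-neighbourhood of `F`, so their volumes have a
bounded sum; radii at most 1 also give `r^s ≤ r^d`. -/
theorem packingSum_lt_top {F : Set (EuclideanSpace ℝ (Fin d))} (hF : Bornology.IsBounded F)
    {s : ℝ≥0} (hs : (d : ℝ) ≤ s) : packingSum s 1 F < ∞ := by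
  set ω := volume (ball (0 : EuclideanSpace ℝ (Fin d)) 1)
  have hω0 : ω ≠ 0 := volume_unitBall_ne_zero
  have hω : ω ≠ ∞ := volume_unitBall_ne_top
  have hfin : volume (cthickening 1 F) < ∞ := hF.cthickening.measure_lt_top
  refine lt_of_le_of_lt (b := ENNReal.ofReal (2 ^ (s : ℝ)) * (volume (cthickening 1 F) / ω)) ?_
    (ENNReal.mul_lt_top ENNReal.ofReal_lt_top (ENNReal.div_lt_top hfin.ne hω0))
  refine iSup₂_le fun P hP => ?_
  have h1 : ∀ p ∈ P, ENNReal.ofReal ((2 * p.2) ^ (s : ℝ)) ≤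
      ENNReal.ofReal (2 ^ (s : ℝ)) * ENNReal.ofReal (p.2 ^ d) := by
    intro p hp
    obtain ⟨-, h0, h1⟩ := hP.1 p hp
    rw [← ENNReal.ofReal_mul (by positivity), Real.mul_rpow (by norm_num) h0.le]
    refine ENNReal.ofReal_le_ofReal (mul_le_mul_of_nonneg_left ?_ (by positivity))
    rw [← Real.rpow_natCast p.2 d]
    exact Real.rpow_le_rpow_of_exponent_ge h0 h1 hs
  refine (Finset.sum_le_sum h1).trans ?_
  rw [← Finset.mul_sum]
  gcongr
  rw [ENNReal.le_div_iff_mul_le (Or.inl hω0) (Or.inl hω), Finset.sum_mul]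
  have h2 : ∀ p ∈ P, ENNReal.ofReal (p.2 ^ d) * ω = volume (closedBall p.1 p.2) := fun p hp =>
    (volume_closedBall_eq p.1 (hP.1 p hp).2.1.le).symm
  rw [Finset.sum_congr rfl h2, ← measure_biUnion_finset hP.2 fun _ _ => measurableSet_closedBall]
  refine measure_mono (iUnion₂_subset fun p hp => ?_)
  exact (closedBall_subset_closedBall (hP.1 p hp).2.2).trans
    (closedBall_subset_cthickening (hP.1 p hp).1 1)

theorem packingPremeasure_empty {X : Type*} [MetricSpace X] (s : ℝ≥0) :
    packingPremeasure s (∅ : Set X) = 0 := by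
  refine le_antisymm ((iInf₂_le 1 one_pos).trans (iSup₂_le fun P hP => ?_)) bot_le
  have : P = ∅ := Finset.eq_empty_of_forall_notMem fun p hp => (hP.1 p hp).1
  simp [this]

theorem packingMeasure_le_packingPremeasure {X : Type*} [MetricSpace X] (s : ℝ≥0) (F : Set X) :
    packingMeasure s F ≤ packingPremeasure s F := by
  refine (iInf₂_le (fun n => if n = 0 then F else ∅) fun x hx =>
    mem_iUnion.2 ⟨0, by simpa using hx⟩).trans ?_
  rw [tsum_eq_single 0 fun n hn => by simp [hn, packingPremeasure_empty]]
  simp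

theorem packingDim_le {F : Set (EuclideanSpace ℝ (Fin d))} (hF : Bornology.IsBounded F) :
    packingDim F ≤ d := by
  refine iSup₂_le fun s hs => ?_
  by_contra! hlt
  have hds : (d : ℝ) ≤ s := by
    have : (d : ℝ≥0) < s := by exact_mod_cast hlt
    exact_mod_cast this.le
  refine (packingSum_lt_top hF hds).ne (top_le_iff.1 ?_)
  rw [← hs]
  exact (packingMeasure_le_packingPremeasure s F).trans (iInf₂_le 1 one_pos)

/-- A Vitali subfamily of the `ε`-balls centred in `A` is a packing at a single scale, and its
5-fold enlargements cover every point of `closure A`. Comparing `(5ε)^d` with `(2ε)^s` leaves the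
factor `ε^(d-s)`, which tends to 0 when `s < d`. -/
theorem volume_le_packingSum_mul {A : Set (EuclideanSpace ℝ (Fin d))}
    {z : EuclideanSpace ℝ (Fin d)} {ρ : ℝ} (hA : ball z ρ ⊆ closure A)
    (s : ℝ≥0) {ε δ : ℝ} (hε : 0 < ε) (hεδ : ε ≤ δ) :
    volume (ball z ρ) ≤ packingSum s δ A *
      ENNReal.ofReal (5 ^ d * ε ^ ((d : ℝ) - s)) *
        volume (ball (0 : EuclideanSpace ℝ (Fin d)) 1) := by
  set ω := volume (ball (0 : EuclideanSpace ℝ (Fin d)) 1)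
  obtain ⟨u, huA, hdisj, hcov⟩ := Vitali.exists_disjoint_subfamily_covering_enlargement_closedBall
    A (fun a => a) (fun _ => ε) ε (fun _ _ => le_rfl) 5 (by norm_num)
  have hpack : ∑' _a : u, ENNReal.ofReal ((2 * ε) ^ (s : ℝ)) ≤ packingSum s δ A := by
    rw [ENNReal.tsum_eq_iSup_sum]
    refine iSup_le fun T => ?_
    classical
    let P : Finset (EuclideanSpace ℝ (Fin d) × ℝ) :=
      T.map ⟨fun a : u => ((a : EuclideanSpace ℝ (Fin d)), ε), fun a b h => by
        simpa [Subtype.ext_iff] using h⟩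
    have hP : IsBallPacking A δ P := by
      refine ⟨fun p hp => ?_, ?_⟩
      · obtain ⟨a, -, rfl⟩ := Finset.mem_map.1 hp
        exact ⟨huA a.2, hε, hεδ⟩
      · intro p hp q hq hpq
        obtain ⟨a, -, rfl⟩ := Finset.mem_map.1 (Finset.mem_coe.1 hp)
        obtain ⟨b, -, rfl⟩ := Finset.mem_map.1 (Finset.mem_coe.1 hq)
        exact hdisj a.2 b.2 fun h => hpq (Prod.ext h rfl)
    refine le_trans (le_of_eq ?_) (le_iSup₂ P hP)
    rw [Finset.sum_map]
    rfl
  have hcount : u.Countable := hdisj.countable_of_nonempty_interior fun a _ =>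
    ⟨a, ball_subset_interior_closedBall (mem_ball_self hε)⟩
  have hsub : ball z ρ ⊆ ⋃ a ∈ u, closedBall a (5 * ε) := by
    intro y hy
    obtain ⟨a, haA, ha⟩ := Metric.mem_closure_iff.1 (hA hy) ε hε
    obtain ⟨b, hb, hab⟩ := hcov a haA
    exact mem_biUnion hb (hab ha.le)
  have hterm : ∀ a : u, volume (closedBall (a : EuclideanSpace ℝ (Fin d)) (5 * ε)) ≤
      ENNReal.ofReal ((2 * ε) ^ (s : ℝ)) * (ENNReal.ofReal (5 ^ d * ε ^ ((d : ℝ) - s)) * ω) := by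
    intro a
    rw [volume_closedBall_eq _ (by positivity), ← mul_assoc,
      ← ENNReal.ofReal_mul (by positivity)]
    gcongr
    rw [Real.mul_rpow (by norm_num) hε.le, mul_pow, ← Real.rpow_natCast ε d]
    have h2 : (1 : ℝ) ≤ 2 ^ (s : ℝ) := Real.one_le_rpow (by norm_num) s.2
    have h3 : ε ^ (d : ℝ) = ε ^ (s : ℝ) * ε ^ ((d : ℝ) - s) := by
      rw [← Real.rpow_add hε]; congr 1; ring
    rw [h3]
    calc (5 : ℝ) ^ d * (ε ^ (s : ℝ) * ε ^ ((d : ℝ) - s))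
        = 1 * (5 ^ d * (ε ^ (s : ℝ) * ε ^ ((d : ℝ) - s))) := (one_mul _).symm
      _ ≤ 2 ^ (s : ℝ) * (5 ^ d * (ε ^ (s : ℝ) * ε ^ ((d : ℝ) - s))) := by gcongr
      _ = _ := by ring
  calc volume (ball z ρ) ≤ volume (⋃ a ∈ u, closedBall a (5 * ε)) := measure_mono hsub
    _ ≤ ∑' a : u, volume (closedBall (a : EuclideanSpace ℝ (Fin d)) (5 * ε)) :=
        measure_biUnion_le _ hcount _
    _ ≤ ∑' _a : u, ENNReal.ofReal ((2 * ε) ^ (s : ℝ)) *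
          (ENNReal.ofReal (5 ^ d * ε ^ ((d : ℝ) - s)) * ω) := ENNReal.tsum_le_tsum hterm
    _ ≤ _ := by
        rw [ENNReal.tsum_mul_right, mul_assoc]
        gcongr

theorem packingPremeasure_eq_top {A : Set (EuclideanSpace ℝ (Fin d))}
    (hA : (interior (closure A)).Nonempty) {s : ℝ≥0} (hs : (s : ℝ) < d) :
    packingPremeasure s A = ∞ := by
  obtain ⟨z, hz⟩ := hA
  obtain ⟨ρ, hρ, hzρ⟩ := Metric.isOpen_iff.1 isOpen_interior z hz
  have hball : ball z ρ ⊆ closure A := hzρ.trans interior_subset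
  refine iInf₂_eq_top.2 fun δ hδ => ?_
  by_contra hne
  set ω := volume (ball (0 : EuclideanSpace ℝ (Fin d)) 1)
  have hω : ω ≠ ∞ := volume_unitBall_ne_top
  have hlim : Tendsto (fun ε : ℝ => packingSum s δ A *
      ENNReal.ofReal (5 ^ d * ε ^ ((d : ℝ) - s)) * ω) (𝓝[>] 0) (𝓝 0) := by
    have h1 : Tendsto (fun ε : ℝ => 5 ^ d * ε ^ ((d : ℝ) - s)) (𝓝[>] 0) (𝓝 0) := by
      have h0 : (0 : ℝ) < d - s := by linarith
      have := (Real.continuousAt_rpow_const 0 ((d : ℝ) - s) (Or.inr h0.le)).tendsto.const_mul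
        ((5 : ℝ) ^ d)
      rw [Real.zero_rpow h0.ne', mul_zero] at this
      exact this.mono_left nhdsWithin_le_nhds
    have h2 := ENNReal.tendsto_ofReal h1
    rw [ENNReal.ofReal_zero] at h2
    have h3 := ENNReal.Tendsto.mul_const (ENNReal.Tendsto.const_mul h2 (Or.inr hne))
      (Or.inr hω)
    simpa using h3
  have hle : volume (ball z ρ) ≤ 0 := by
    refine ge_of_tendsto hlim ?_
    filter_upwards [Ioo_mem_nhdsGT hδ] with ε hε
    exact volume_le_packingSum_mul hball s hε.1 hε.2.le
  exact (measure_ball_pos volume z hρ).not_ge hle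

/-- A countable intersection of open sets, each dense in a fixed nonempty open set, has full packing
dimension. -/
theorem le_packingDim_of_limsup_dense {E : ℕ → Set (EuclideanSpace ℝ (Fin d))}
    (hE : ∀ i, IsOpen (E i)) {U : Set (EuclideanSpace ℝ (Fin d))} (hU : IsOpen U)
    (hne : U.Nonempty) (hdense : ∀ n, U ⊆ closure (⋃ i ≥ n, E i)) :
    (d : ℝ≥0∞) ≤ packingDim (limsup E atTop) := by
  refine le_of_forall_lt fun a ha => ?_
  obtain ⟨s, has, hsd⟩ := ENNReal.lt_iff_exists_nnreal_btwn.1 ha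
  have hsd' : (s : ℝ) < d := by
    have : s < (d : ℝ≥0) := by exact_mod_cast hsd
    exact_mod_cast this
  refine has.trans_le (le_iSup₂_of_le s ?_ le_rfl)
  refine iInf₂_eq_top.2 fun A hA => ?_
  obtain ⟨n, hn⟩ : ∃ n, (interior (closure (A n))).Nonempty := by
    by_contra! hcon
    -- Adding the exterior of `U` makes each open set dense in the whole space, where Baire's
    -- theorem applies.
    have hd1 : Dense (⋂ n, ((⋃ i ≥ n, E i) ∪ (closure U)ᶜ)) := by
      refine dense_iInter_of_isOpen_nat
        (fun n => (isOpen_biUnion fun i _ => hE i).union isClosed_closure.isOpen_compl) fun n => ?_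
      rw [dense_iff_closure_eq, closure_union, eq_univ_iff_forall]
      intro x
      by_cases hx : x ∈ closure U
      · exact Or.inl (closure_minimal (hdense n) isClosed_closure hx)
      · exact Or.inr (subset_closure hx)
    have hd2 : Dense (⋂ n, (closure (A n))ᶜ) :=
      dense_iInter_of_isOpen_nat (fun n => isClosed_closure.isOpen_compl) fun n =>
        interior_eq_empty_iff_dense_compl.1 (hcon n)
    have ho : ∀ n, IsOpen ((⋃ i ≥ n, E i) ∪ (closure U)ᶜ) := fun n =>
      (isOpen_biUnion fun i _ => hE i).union isClosed_closure.isOpen_compl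
    have hd3 := hd1.inter_of_Gδ (IsGδ.iInter_of_isOpen ho)
      (IsGδ.iInter_of_isOpen fun n => (isClosed_closure (s := A n)).isOpen_compl) hd2
    obtain ⟨x, hxU, hx1, hx2⟩ := hd3.inter_open_nonempty U hU hne
    have hxE : x ∈ limsup E atTop := by
      rw [limsup_eq_iInf_iSup_of_nat]
      refine mem_iInter.2 fun n => ?_
      rcases mem_iInter.1 hx1 n with h | h
      · exact h
      · exact absurd (subset_closure hxU) h
    obtain ⟨n, hn⟩ := mem_iUnion.1 (hA hxE)
    exact mem_iInter.1 hx2 n (subset_closure hn)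
  exact top_le_iff.1 ((packingPremeasure_eq_top hn hsd').ge.trans
    (ENNReal.le_tsum (f := fun n => packingPremeasure s (A n)) n))

end PackingDimension

/-! ### Frostman measures from the singular value function -/

section Frostman

variable {d : ℕ}

/-- If `φ^t(E)` exceeds `a`, some probability measure on `E` satisfies the ball condition
`a μ(B_r(x)) ≤ (2 r)^t` at every point of the space. -/
theorem exists_measure_of_lt_singularValue {t : ℝ≥0} {E : Set (EuclideanSpace ℝ (Fin d))}
    {a : ℝ≥0∞} (h : a < singularValue t E) :
    ∃ μ : Measure (EuclideanSpace ℝ (Fin d)), IsProbabilityMeasure μ ∧ μ Eᶜ = 0 ∧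
      ∀ x, ∀ r > 0, a * μ (closedBall x r) ≤ ENNReal.ofReal ((2 * r) ^ (t : ℝ)) := by
  obtain ⟨μ, hμ⟩ := lt_iSup_iff.1 h
  obtain ⟨⟨hp, hE⟩, hμ⟩ := lt_iSup_iff.1 hμ
  refine ⟨μ, hp, hE, fun x r hr => ?_⟩
  by_cases hx : (closedBall x r ∩ E).Nonempty
  · obtain ⟨y, hyx, hyE⟩ := hx
    have h1 : a ≤ ENNReal.ofReal ((2 * r) ^ (t : ℝ)) / μ (closedBall y (2 * r)) :=
      hμ.le.trans ((iInf₂_le y hyE).trans (iInf₂_le (2 * r) (by positivity)))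
    have h2 : closedBall x r ⊆ closedBall y (2 * r) := by
      refine closedBall_subset_closedBall' ?_
      rw [dist_comm]
      linarith [mem_closedBall.1 hyx]
    calc a * μ (closedBall x r) ≤ a * μ (closedBall y (2 * r)) := by gcongr
      _ ≤ _ := ENNReal.mul_le_of_le_div h1
  · have : μ (closedBall x r) = 0 := by
      refine measure_mono_null (fun y hy hyE => hx ⟨y, hy, hyE⟩) hE
    simp [this]

/-- Mollification of a measure supported on a compact subset of an open set. -/
theorem exists_mollification {μ : Measure (EuclideanSpace ℝ (Fin d))} [IsProbabilityMeasure μ]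
    {K E : Set (EuclideanSpace ℝ (Fin d))} (hK : IsCompact K) (hE : IsOpen E) (hKE : K ⊆ E)
    (hμ : μ Kᶜ = 0) :
    ∃ (ν : Measure (EuclideanSpace ℝ (Fin d))) (L : Set (EuclideanSpace ℝ (Fin d))) (M : ℝ≥0),
      IsProbabilityMeasure ν ∧ IsCompact L ∧ L ⊆ E ∧ ν Lᶜ = 0 ∧ ν ≤ M • volume ∧
      ∀ (b : ℝ≥0∞) (r : ℝ), (∀ x, μ (closedBall x r) ≤ b) → ∀ x, ν (closedBall x r) ≤ b := by
  obtain ⟨ε, hε, hεE⟩ := hK.exists_cthickening_subset_open hE hKE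
  set D : Set (EuclideanSpace ℝ (Fin d)) := closedBall 0 ε
  set κ : Measure (EuclideanSpace ℝ (Fin d)) := ProbabilityTheory.cond volume D
  have hD0 : volume D ≠ 0 := (measure_closedBall_pos volume _ hε).ne'
  have hDt : volume D ≠ ∞ := measure_closedBall_lt_top.ne
  have hκ : IsProbabilityMeasure κ := ProbabilityTheory.cond_isProbabilityMeasure_of_finite hD0 hDt
  -- The convolution is an average of translates of `μ`, which preserves uniform ball bounds, and
  -- also an average of translates of `κ`, which gives the support and the density bound.
  have hconv : ∀ s, MeasurableSet s → (κ ∗ μ) s = ∫⁻ x, μ ((fun y => x + y) ⁻¹' s) ∂κ := by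
    intro s hs
    rw [← lintegral_indicator_one hs, Measure.lintegral_conv (by measurability)]
    refine lintegral_congr fun x => ?_
    rw [← lintegral_indicator_one (by measurability)]
    rfl
  have hconv' : ∀ s, MeasurableSet s → (κ ∗ μ) s = ∫⁻ y, κ ((fun x => y + x) ⁻¹' s) ∂μ := by
    intro s hs
    rw [Measure.conv_comm, ← lintegral_indicator_one hs,
      Measure.lintegral_conv (by measurability)]
    refine lintegral_congr fun x => ?_
    rw [← lintegral_indicator_one (by measurability)]
    rfl
  refine ⟨κ ∗ μ, cthickening ε K, ((volume D)⁻¹).toNNReal, inferInstance, hK.cthickening, hεE,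
    ?_, ?_, ?_⟩
  · rw [hconv' _ isClosed_cthickening.measurableSet.compl, ← lintegral_zero (μ := μ)]
    have hK' : ∀ᵐ y ∂μ, y ∈ K := hμ
    refine lintegral_congr_ae (hK'.mono fun y hy => ?_)
    refine measure_mono_null (t := Dᶜ) (fun x hx hxD => hx ?_)
      (ProbabilityTheory.ae_cond_mem measurableSet_closedBall)
    refine closedBall_subset_cthickening hy ε ?_
    simpa [D] using hxD
  · refine Measure.le_iff.2 fun s hs => ?_
    rw [hconv' s hs]
    calc ∫⁻ y, κ ((fun x => y + x) ⁻¹' s) ∂μ ≤ ∫⁻ _y, (volume D)⁻¹ * volume s ∂μ := by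
          refine lintegral_mono fun y => ?_
          rw [← measure_preimage_add volume y s]
          rw [ProbabilityTheory.cond_apply measurableSet_closedBall]
          gcongr
          exact inter_subset_right
      _ = _ := by
          rw [lintegral_const, measure_univ, mul_one, Measure.smul_apply, ENNReal.smul_def,
            smul_eq_mul, ENNReal.coe_toNNReal (ENNReal.inv_ne_top.2 hD0)]
  · intro b r hb x
    rw [hconv _ measurableSet_closedBall]
    calc ∫⁻ z, μ ((fun y => z + y) ⁻¹' closedBall x r) ∂κ ≤ ∫⁻ _z, b ∂κ := by
          refine lintegral_mono fun z => ?_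
          convert hb (x - z) using 2
          ext y
          simp [dist_eq_norm, sub_sub_eq_add_sub, add_comm]
      _ = b := by simp

/-- The factor 4 is 2 · 2: the supremum in `φ^t` need not be attained, so `a` is replaced by `a /
2`; conditioning on a compact set of mass above 1/2 costs another 2. Mollification costs nothing. -/
theorem exists_smooth_measure_of_le_singularValue {t : ℝ≥0}
    {E : Set (EuclideanSpace ℝ (Fin d))} (hE : IsOpen E) {a : ℝ≥0∞} (ha0 : a ≠ 0) (ha : a ≠ ∞)
    (h : a ≤ singularValue t E) :
    ∃ (ν : Measure (EuclideanSpace ℝ (Fin d))) (L : Set (EuclideanSpace ℝ (Fin d))) (M : ℝ≥0),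
      IsProbabilityMeasure ν ∧ IsCompact L ∧ L ⊆ E ∧ ν Lᶜ = 0 ∧ ν ≤ M • volume ∧
      ∀ x, ∀ r > 0, a * ν (closedBall x r) ≤ ENNReal.ofReal (4 * (2 * r) ^ (t : ℝ)) := by
  obtain ⟨μ, hμ, hμE, hμb⟩ := exists_measure_of_lt_singularValue
    ((ENNReal.half_lt_self ha0 ha).trans_le h)
  have hE1 : μ E = 1 := by
    rw [← prob_compl_eq_zero_iff hE.measurableSet, hμE]
  obtain ⟨K, hKE, hK, hμK⟩ := hE.exists_lt_isCompact (μ := μ) (r := 2⁻¹)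
    (by rw [hE1]; exact ENNReal.one_half_lt_one)
  have hK0 : μ K ≠ 0 := (bot_le.trans_lt hμK).ne'
  have hp : IsProbabilityMeasure (ProbabilityTheory.cond μ K) :=
    ProbabilityTheory.cond_isProbabilityMeasure hK0
  obtain ⟨ν, L, M, hν, hL, hLE, hνL, hνM, hνb⟩ :=
    exists_mollification (μ := ProbabilityTheory.cond μ K) hK hE hKE (by
      rw [ProbabilityTheory.cond_apply hK.measurableSet]; simp)
  refine ⟨ν, L, M, hν, hL, hLE, hνL, hνM, fun x r hr => ?_⟩
  rw [mul_comm, ← ENNReal.le_div_iff_mul_le (Or.inl ha0) (Or.inl ha)]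
  refine hνb _ r (fun y => ?_) x
  rw [ENNReal.le_div_iff_mul_le (Or.inl ha0) (Or.inl ha)]
  have h1 : ProbabilityTheory.cond μ K (closedBall y r) ≤ 2 * μ (closedBall y r) := by
    rw [ProbabilityTheory.cond_apply hK.measurableSet]
    gcongr
    · exact (ENNReal.inv_le_inv.2 hμK.le).trans (by simp)
    · exact inter_subset_right
  calc _ ≤ 2 * μ (closedBall y r) * a := by gcongr
    _ = 2 * μ (closedBall y r) * (2 * (a / 2)) := by
        rw [ENNReal.mul_div_cancel (by norm_num) (by norm_num)]
    _ = 4 * (a / 2 * μ (closedBall y r)) := by ring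
    _ ≤ 4 * ENNReal.ofReal ((2 * r) ^ (t : ℝ)) := by gcongr; exact hμb y r hr
    _ = _ := by rw [ENNReal.ofReal_mul (by norm_num)]; simp

/-- A Frostman measure of exponent `t` forces `t ≤ d`. -/
theorem le_of_frostman {t : ℝ≥0} {μ : Measure (EuclideanSpace ℝ (Fin d))}
    [IsProbabilityMeasure μ] {a : ℝ≥0∞} (ha0 : a ≠ 0) {C : ℝ≥0}
    (h : ∀ x, ∀ r > 0, a * μ (closedBall x r) ≤ ENNReal.ofReal (C * r ^ (t : ℝ))) :
    t ≤ d := by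
  by_contra! hlt
  have hzero : μH[(t : ℝ)] (univ : Set (EuclideanSpace ℝ (Fin d))) = 0 := by
    refine hausdorffMeasure_of_dimH_lt ?_
    rw [Real.dimH_univ_eq_finrank, finrank_euclideanSpace_fin]
    exact_mod_cast hlt
  have hle : (a / C) • μ ≤ μH[(t : ℝ)] := by
    refine Measure.le_hausdorffMeasure _ _ 1 one_pos fun s hs => ?_
    rcases s.eq_empty_or_nonempty with rfl | ⟨x, hx⟩
    · simp
    have hb : ediam s ≠ ∞ := (hs.trans_lt ENNReal.one_lt_top).ne
    -- The ball bound needs a positive radius while the diameter may vanish, so the diameter is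
    -- approached from above.
    have hsub : ∀ r, (ediam s).toReal < r → a * μ s ≤ ENNReal.ofReal (C * r ^ (t : ℝ)) := by
      intro r hr
      refine le_trans ?_ (h x r (ENNReal.toReal_nonneg.trans_lt hr))
      gcongr
      intro y hy
      rw [mem_closedBall, dist_edist]
      exact (ENNReal.toReal_mono hb (edist_le_ediam_of_mem hy hx)).trans hr.le
    have hlim : Tendsto (fun r : ℝ => ENNReal.ofReal (C * r ^ (t : ℝ)))
        (𝓝[>] (ediam s).toReal) (𝓝 (ENNReal.ofReal (C * (ediam s).toReal ^ (t : ℝ)))) :=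
      (ENNReal.tendsto_ofReal ((Real.continuousAt_rpow_const _ _
        (Or.inr t.2)).tendsto.const_mul _)).mono_left nhdsWithin_le_nhds
    have h2 : a * μ s ≤ C * ediam s ^ (t : ℝ) := by
      have := ge_of_tendsto hlim (eventually_mem_nhdsWithin.mono hsub)
      rwa [ENNReal.ofReal_mul (NNReal.coe_nonneg C), ← ENNReal.ofReal_rpow_of_nonneg ENNReal.toReal_nonneg t.coe_nonneg,
        ENNReal.ofReal_toReal hb, ENNReal.ofReal_coe_nnreal] at this
    rw [Measure.smul_apply, smul_eq_mul, ← ENNReal.mul_div_right_comm]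
    exact ENNReal.div_le_of_le_mul' h2
  have := hle univ
  rw [hzero] at this
  simp [ha0] at this
end Frostman

/-! ### Vitali selection and overlap counting -/

section Covering

variable {d : ℕ}

/-- A finite disjoint subfamily of a Vitali family of balls exhausting an absolutely continuous
measure up to a prescribed error. -/
theorem exists_finset_disjoint_closedBall {c : ℕ → EuclideanSpace ℝ (Fin d)} {r : ℕ → ℝ}
    (hr : ∀ i, 0 < r i) (hr0 : Tendsto r atTop (𝓝 0)) {P : ℕ → Prop}
    {U : Set (EuclideanSpace ℝ (Fin d))} (hU : IsOpen U)
    (hcov : ∀ᵐ x ∂volume, x ∈ U → ∃ᶠ i in atTop, P i ∧ x ∈ closedBall (c i) (r i))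
    {ν : Measure (EuclideanSpace ℝ (Fin d))} (hν : ν ≪ volume) (hνU : ν Uᶜ = 0)
    {m : ℝ≥0∞} (hm : m < ν univ) {ρ : ℝ} (hρ : 0 < ρ) (N : ℕ) :
    ∃ J : Finset ℕ, (∀ i ∈ J, N ≤ i ∧ P i ∧ r i ≤ ρ ∧ closedBall (c i) (r i) ⊆ U) ∧
      (J : Set ℕ).PairwiseDisjoint (fun i => closedBall (c i) (r i)) ∧
      m < ν (⋃ i ∈ J, closedBall (c i) (r i)) := by
  set s : Set (EuclideanSpace ℝ (Fin d)) :=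
    {x | x ∈ U ∧ ∃ᶠ i in atTop, P i ∧ x ∈ closedBall (c i) (r i)}
  -- Pairs (point, index) let Vitali's theorem treat a ball containing `x` but not centred there: it
  -- lies in the ball of radius `2 r_i` about `x`, and tripling that radius gives the ratio `6^d`.
  set T : Set (EuclideanSpace ℝ (Fin d) × ℕ) := {p | (N ≤ p.2 ∧ P p.2 ∧ r p.2 ≤ ρ ∧
    closedBall (c p.2) (r p.2) ⊆ U) ∧ p.1 ∈ closedBall (c p.2) (r p.2)}
  obtain ⟨u, huT, -, hdisj, hnull⟩ := Vitali.exists_disjoint_covering_ae volume s T (6 ^ d)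
    (fun p => 2 * r p.2) (fun p => p.1) (fun p => closedBall (c p.2) (r p.2))
    (by
      intro p hp
      refine closedBall_subset_closedBall' ?_
      have := mem_closedBall'.1 hp.2
      linarith)
    (by
      intro p _
      rw [show 3 * (2 * r p.2) = 6 * r p.2 by ring,
        volume_closedBall_mul p.1 (c p.2) (by norm_num) (hr p.2).le]
      gcongr
      rw [ENNReal.ofReal_pow (by norm_num)]
      simp)
    (fun p _ => ⟨c p.2, ball_subset_interior_closedBall (mem_ball_self (hr p.2))⟩)
    (fun p _ => isClosed_closedBall)
    (by
      rintro x ⟨hxU, hx⟩ ε hε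
      obtain ⟨η, hη, hηU⟩ := Metric.isOpen_iff.1 hU x hxU
      have hsmall : ∀ᶠ i in atTop, r i < min (min ρ (ε / 2)) (η / 2) :=
        hr0.eventually (gt_mem_nhds (by positivity))
      obtain ⟨i, ⟨hPi, hxi⟩, hri, hNi⟩ := (hx.and_eventually
        (hsmall.and (eventually_ge_atTop N))).exists
      simp only [lt_min_iff] at hri
      refine ⟨(x, i), ⟨⟨hNi, hPi, hri.1.1.le, ?_⟩, hxi⟩, by simp only; linarith, rfl⟩
      intro y hy
      refine hηU ?_
      have h1 := mem_closedBall.1 hy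
      have h2 := mem_closedBall'.1 hxi
      have h3 := dist_triangle y (c i) x
      rw [mem_ball]
      linarith)
  set u' : Set ℕ := Prod.snd '' u
  have hu'P : ∀ i ∈ u', N ≤ i ∧ P i ∧ r i ≤ ρ ∧ closedBall (c i) (r i) ⊆ U := by
    rintro _ ⟨p, hp, rfl⟩
    exact (huT hp).1
  have hu'disj : u'.PairwiseDisjoint (fun i => closedBall (c i) (r i)) := by
    rintro _ ⟨p, hp, rfl⟩ _ ⟨q, hq, rfl⟩ hpq
    exact hdisj hp hq fun h => hpq (by rw [h])
  have hunion : ⋃ i ∈ u', closedBall (c i) (r i) = ⋃ p ∈ u, closedBall (c p.2) (r p.2) := by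
    exact biUnion_image
  have hae : ∀ᵐ x ∂ν, x ∈ ⋃ i ∈ u', closedBall (c i) (r i) := by
    have h1 : ∀ᵐ x ∂ν, x ∈ U := hνU
    have h2 : ∀ᵐ x ∂ν, x ∉ s \ ⋃ p ∈ u, closedBall (c p.2) (r p.2) :=
      measure_eq_zero_iff_ae_notMem.1 (hν hnull)
    filter_upwards [h1, hν.ae_le hcov, h2] with x hx1 hx2 hx3
    by_contra hx
    rw [hunion] at hx
    exact hx3 ⟨⟨hx1, hx2 hx1⟩, hx⟩
  have hmass : m < ∑' i : u', ν (closedBall (c i) (r i)) := by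
    rw [← measure_biUnion (to_countable u') hu'disj fun i _ => measurableSet_closedBall,
      measure_congr (eventuallyEq_univ.2 hae : (⋃ i ∈ u', closedBall (c i) (r i)) =ᵐ[ν] univ)]
    exact hm
  rw [ENNReal.tsum_eq_iSup_sum] at hmass
  obtain ⟨F, hF⟩ := lt_iSup_iff.1 hmass
  have hFu : ∀ i ∈ F.map (Function.Embedding.subtype _), i ∈ u' := by
    intro i hi
    obtain ⟨j, -, rfl⟩ := Finset.mem_map.1 hi
    exact j.2
  have hJdisj : ((F.map (Function.Embedding.subtype _) : Finset ℕ) : Set ℕ).PairwiseDisjoint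
      (fun i => closedBall (c i) (r i)) := hu'disj.subset hFu
  refine ⟨F.map (Function.Embedding.subtype _), fun i hi => hu'P i (hFu i hi), hJdisj, ?_⟩
  rw [measure_biUnion_finset hJdisj fun i _ => measurableSet_closedBall, Finset.sum_map]
  exact hF

/-- A ball meeting `closedBall x s` contains a ball of radius `min r s` inside
`closedBall x (3 * s)`. -/
theorem exists_closedBall_subset_inter {V : Type*} [NormedAddCommGroup V] [NormedSpace ℝ V]
    {c x : V} {r s : ℝ} (hr : 0 < r) (hs : 0 < s)
    (h : (closedBall c r ∩ closedBall x s).Nonempty) :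
    ∃ z, closedBall z (min r s) ⊆ closedBall c r ∩ closedBall x (3 * s) := by
  obtain ⟨y, hyc, hyx⟩ := h
  rw [mem_closedBall] at hyc hyx
  rw [dist_comm, dist_eq_norm] at hyc
  set a := min r s
  have ha : 0 < a := lt_min hr hs
  have har : a / r ≤ 1 := (div_le_one hr).2 (min_le_left _ _)
  have h0 : 0 ≤ a / r := by positivity
  -- The new centre is `y` pulled towards `c` by the fraction `a / r`: within `a` of `y` and within
  -- `r - a` of `c`.
  have hz1 : dist (y + (a / r) • (c - y)) y ≤ a := by
    rw [dist_eq_norm, add_sub_cancel_left, norm_smul, Real.norm_of_nonneg h0]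
    calc a / r * ‖c - y‖ ≤ a / r * r := by gcongr
      _ = a := by field_simp
  have hz2 : dist (y + (a / r) • (c - y)) c ≤ r - a := by
    rw [dist_comm, dist_eq_norm,
      show c - (y + (a / r) • (c - y)) = (1 - a / r) • (c - y) by module,
      norm_smul, Real.norm_of_nonneg (by linarith)]
    calc (1 - a / r) * ‖c - y‖ ≤ (1 - a / r) * r := by gcongr
      _ = r - a := by field_simp
  refine ⟨y + (a / r) • (c - y), subset_inter (closedBall_subset_closedBall' (by linarith))
    (closedBall_subset_closedBall' ?_)⟩
  have := dist_triangle (y + (a / r) • (c - y)) y x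
  have : a ≤ s := min_le_right _ _
  linarith

/-- Only balls meeting `B_s(x)` contribute. Each contains a ball of radius `min r_i s` inside
`B_{3s}(x)`; these are disjoint, so their volumes sum to at most `3^d λ(B_s)`. A term with `r_i ≤ s`
is controlled by `μ_i ≤ 1`, one with `r_i ≥ s` by `b`. -/
theorem sum_mul_measure_closedBall_le {c : ℕ → EuclideanSpace ℝ (Fin d)} {r : ℕ → ℝ}
    (hr : ∀ i, 0 < r i) {J : Finset ℕ}
    (hJ : (J : Set ℕ).PairwiseDisjoint (fun i => closedBall (c i) (r i)))
    {ν : Measure (EuclideanSpace ℝ (Fin d))} {M : ℝ≥0} (hν : ν ≤ M • volume)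
    {μ : ℕ → Measure (EuclideanSpace ℝ (Fin d))} (hμ : ∀ i ∈ J, IsProbabilityMeasure (μ i))
    (hμB : ∀ i ∈ J, μ i (closedBall (c i) (r i))ᶜ = 0)
    {x : EuclideanSpace ℝ (Fin d)} {s : ℝ} (hs : 0 < s) {b : ℝ≥0∞}
    (hb : ∀ i ∈ J, volume (closedBall (c i) (r i)) * μ i (closedBall x s) ≤ b) :
    ∑ i ∈ J, ν (closedBall (c i) (r i)) * μ i (closedBall x s) ≤
      M * 3 ^ d * (volume (closedBall x s) + b) := by
  classical
  have hv0 : volume (closedBall x s) ≠ 0 := (measure_closedBall_pos volume x hs).ne'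
  have hvt : volume (closedBall x s) ≠ ∞ := measure_closedBall_lt_top.ne
  have hνle : ∀ A, ν A ≤ M * volume A := fun A => hν A
  set J' := J.filter fun i => (closedBall (c i) (r i) ∩ closedBall x s).Nonempty
  have hJJ' : ∑ i ∈ J', ν (closedBall (c i) (r i)) * μ i (closedBall x s) =
      ∑ i ∈ J, ν (closedBall (c i) (r i)) * μ i (closedBall x s) := by
    refine Finset.sum_filter_of_ne fun i hi hne => ?_
    by_contra hempty
    refine hne ?_
    rw [measure_mono_null (t := (closedBall (c i) (r i))ᶜ) (fun y hy hyc => hempty ⟨y, hyc, hy⟩)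
      (hμB i hi), mul_zero]
  have hz : ∀ i, ∃ z, i ∈ J' → closedBall z (min (r i) s) ⊆
      closedBall (c i) (r i) ∩ closedBall x (3 * s) := by
    intro i
    by_cases hi : i ∈ J'
    · obtain ⟨z, hz⟩ := exists_closedBall_subset_inter (hr i) hs (Finset.mem_filter.1 hi).2
      exact ⟨z, fun _ => hz⟩
    · exact ⟨0, fun h => absurd h hi⟩
  choose z hz using hz
  have hterm : ∀ i ∈ J', volume (closedBall x s) *
      (ν (closedBall (c i) (r i)) * μ i (closedBall x s)) ≤
      M * (volume (closedBall x s) + b) * volume (closedBall (z i) (min (r i) s)) := by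
    intro i hi
    have hiJ : i ∈ J := (Finset.mem_filter.1 hi).1
    have := hμ i hiJ
    rcases le_total (r i) s with h | h
    · rw [min_eq_left h, volume_closedBall_eq (z i) (hr i).le, ← volume_closedBall_eq (c i) (hr i).le]
      calc volume (closedBall x s) * (ν (closedBall (c i) (r i)) * μ i (closedBall x s))
          ≤ volume (closedBall x s) * (M * volume (closedBall (c i) (r i)) * 1) := by
            gcongr
            · exact hνle _
            · exact prob_le_one
        _ = M * volume (closedBall x s) * volume (closedBall (c i) (r i)) := by ring
        _ ≤ _ := by gcongr; exact le_self_add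
    · rw [min_eq_right h, volume_closedBall_eq (z i) hs.le, ← volume_closedBall_eq x hs.le]
      calc volume (closedBall x s) * (ν (closedBall (c i) (r i)) * μ i (closedBall x s))
          ≤ volume (closedBall x s) *
              (M * volume (closedBall (c i) (r i)) * μ i (closedBall x s)) := by
            gcongr
            exact hνle _
        _ = M * (volume (closedBall (c i) (r i)) * μ i (closedBall x s)) *
              volume (closedBall x s) := by ring
        _ ≤ M * b * volume (closedBall x s) := by gcongr; exact hb i hiJ
        _ ≤ _ := by gcongr; exact le_add_self
  have hdisj : (J' : Set ℕ).PairwiseDisjoint fun i => closedBall (z i) (min (r i) s) := by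
    intro i hi j hj hij
    exact (hJ (Finset.mem_filter.1 hi).1 (Finset.mem_filter.1 hj).1 hij).mono
      ((hz i hi).trans inter_subset_left) ((hz j hj).trans inter_subset_left)
  have hsum : ∑ i ∈ J', volume (closedBall (z i) (min (r i) s)) ≤
      3 ^ d * volume (closedBall x s) := by
    rw [← measure_biUnion_finset hdisj fun i _ => measurableSet_closedBall]
    refine (measure_mono (iUnion₂_subset fun i hi => (hz i hi).trans inter_subset_right)).trans ?_
    rw [volume_closedBall_mul x x (by norm_num) hs.le, ENNReal.ofReal_pow (by norm_num)]
    simp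
  rw [← hJJ']
  refine (ENNReal.mul_le_mul_iff_right hv0 hvt).1 ?_
  calc volume (closedBall x s) * ∑ i ∈ J', ν (closedBall (c i) (r i)) * μ i (closedBall x s)
      ≤ ∑ i ∈ J', M * (volume (closedBall x s) + b) *
          volume (closedBall (z i) (min (r i) s)) := by
        rw [Finset.mul_sum]
        exact Finset.sum_le_sum hterm
    _ ≤ M * (volume (closedBall x s) + b) * (3 ^ d * volume (closedBall x s)) := by
        rw [← Finset.mul_sum]
        gcongr
    _ = _ := by ring

end Covering

/-! ### The refinement step -/

section Construction

variable {d : ℕ}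

/-- A measure carried by the open set `U`, with bounded density, whose balls satisfy
`ν (B_r(x)) ≤ C r^u`. -/
structure IsFrostmanOn (u C : ℝ) (U : Set (EuclideanSpace ℝ (Fin d)))
    (ν : Measure (EuclideanSpace ℝ (Fin d))) : Prop where
  isFiniteMeasure : IsFiniteMeasure ν
  isOpen : IsOpen U
  measure_compl : ν Uᶜ = 0
  le_smul_volume : ∃ M : ℝ≥0, ν ≤ M • volume
  measure_closedBall_le : ∀ x, ∀ r > 0, ν (closedBall x r) ≤ ENNReal.ofReal (C * r ^ u)

/-- At small scales, lower order powers dominate. -/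
theorem exists_forall_lt_add_mul_rpow_le {u t a b C : ℝ} (ht : u < t) (hd : u < d)
    (hC : 0 < C) :
    ∃ R > 0, ∀ r : ℝ, 0 < r → r < R → a * r ^ d + b * r ^ t ≤ C * r ^ u := by
  have h1 : Tendsto (fun r : ℝ => a * r ^ ((d : ℝ) - u) + b * r ^ (t - u)) (𝓝[>] 0) (𝓝 0) := by
    have key : ∀ p : ℝ, 0 < p → Tendsto (fun r : ℝ => r ^ p) (𝓝[>] 0) (𝓝 0) := by
      intro p hp
      have := (Real.continuousAt_rpow_const 0 p (Or.inr hp.le)).tendsto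
      rw [Real.zero_rpow hp.ne'] at this
      exact this.mono_left nhdsWithin_le_nhds
    simpa using ((key _ (sub_pos.2 hd)).const_mul a).add ((key _ (sub_pos.2 ht)).const_mul b)
  obtain ⟨R, hR, hRsub⟩ := mem_nhdsGT_iff_exists_Ioo_subset.1 (h1.eventually (gt_mem_nhds hC))
  refine ⟨R, hR, fun r hr hrR => ?_⟩
  have h2 := (hRsub ⟨hr, hrR⟩ : a * r ^ ((d : ℝ) - u) + b * r ^ (t - u) < C)
  have h3 : r ^ d = r ^ ((d : ℝ) - u) * r ^ u := by
    rw [← Real.rpow_add hr, sub_add_cancel, Real.rpow_natCast]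
  have h4 : r ^ t = r ^ (t - u) * r ^ u := by
    rw [← Real.rpow_add hr, sub_add_cancel]
  have h5 : 0 < r ^ u := Real.rpow_pos_of_pos hr u
  calc a * r ^ d + b * r ^ t = (a * r ^ ((d : ℝ) - u) + b * r ^ (t - u)) * r ^ u := by
        rw [h3, h4]
        ring
    _ ≤ C * r ^ u := mul_le_mul_of_nonneg_right (le_of_lt h2) h5.le

/-- Enlarging the radius slightly costs little at large scales. -/
theorem exists_forall_le_mul_add_rpow_le {u C C' R : ℝ} (hu : 0 ≤ u) (hC : 0 ≤ C) (hCC' : C < C')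
    (hR : 0 < R) :
    ∃ ρ > 0, ∀ r : ℝ, R ≤ r → C * (r + 2 * ρ) ^ u ≤ C' * r ^ u := by
  have h1 : Tendsto (fun ρ : ℝ => C * (1 + 2 * ρ / R) ^ u) (𝓝[>] 0) (𝓝 C) := by
    have : ContinuousAt (fun ρ : ℝ => C * (1 + 2 * ρ / R) ^ u) 0 := by
      refine continuousAt_const.mul (ContinuousAt.rpow_const (by fun_prop) (Or.inr hu))
    have h := this.tendsto
    simp only [mul_zero, zero_div, add_zero, Real.one_rpow, mul_one] at h
    exact h.mono_left nhdsWithin_le_nhds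
  obtain ⟨ρ, h2, hρ⟩ := ((h1.eventually (gt_mem_nhds hCC')).and self_mem_nhdsWithin).exists
  have hρ' : 0 < ρ := hρ
  refine ⟨ρ, hρ', fun r hr => ?_⟩
  have hr0 : 0 < r := hR.trans_le hr
  have h3 : r + 2 * ρ = r * (1 + 2 * ρ / r) := by field_simp
  rw [h3, Real.mul_rpow hr0.le (by positivity)]
  have h4 : (1 + 2 * ρ / r) ^ u ≤ (1 + 2 * ρ / R) ^ u := by gcongr
  have h5 : 0 < r ^ u := Real.rpow_pos_of_pos hr0 u
  calc C * (r ^ u * (1 + 2 * ρ / r) ^ u) ≤ C * (r ^ u * (1 + 2 * ρ / R) ^ u) := by gcongr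
    _ = C * (1 + 2 * ρ / R) ^ u * r ^ u := by ring
    _ ≤ _ := by gcongr

/-- The mass of `ν` on each chosen ball is redistributed inside `E_i`. The order of choices matters:
the density bound `M` of `ν` fixes the scale `R` below which the bounds on the `μ_i` suffice, and
`R` then fixes the maximal radius `ρ` of the chosen balls. -/
theorem IsFrostmanOn.exists_refinement {c : ℕ → EuclideanSpace ℝ (Fin d)} {r : ℕ → ℝ}
    {E : ℕ → Set (EuclideanSpace ℝ (Fin d))} (hr : ∀ i, 0 < r i) (hr0 : Tendsto r atTop (𝓝 0))
    (hEopen : ∀ i, IsOpen (E i)) (hEB : ∀ i, E i ⊆ closedBall (c i) (r i)) {P : ℕ → Prop}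
    {t A : ℝ} (hA : 0 ≤ A)
    (hP : ∀ i, P i → ∃ (ν : Measure (EuclideanSpace ℝ (Fin d)))
      (L : Set (EuclideanSpace ℝ (Fin d))) (M : ℝ≥0),
      IsProbabilityMeasure ν ∧ IsCompact L ∧ L ⊆ E i ∧ ν Lᶜ = 0 ∧ ν ≤ M • volume ∧
      ∀ x, ∀ s > 0, volume (closedBall (c i) (r i)) * ν (closedBall x s) ≤
        ENNReal.ofReal (A * s ^ t))
    {U : Set (EuclideanSpace ℝ (Fin d))}
    (hcov : ∀ᵐ x ∂volume, x ∈ U → ∃ᶠ i in atTop, P i ∧ x ∈ closedBall (c i) (r i))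
    {u C C' : ℝ} (hu : 0 ≤ u) (hut : u < t) (hud : u < d) (hC : 0 ≤ C) (hCC' : C < C')
    {ν : Measure (EuclideanSpace ℝ (Fin d))} (hν : IsFrostmanOn u C U ν)
    {m : ℝ≥0∞} (hm : m < ν univ) (N : ℕ) :
    ∃ (ν' : Measure (EuclideanSpace ℝ (Fin d))) (U' : Set (EuclideanSpace ℝ (Fin d))),
      IsFrostmanOn u C' U' ν' ∧ m < ν' univ ∧ IsCompact (closure U') ∧ closure U' ⊆ U ∧
        closure U' ⊆ ⋃ i ≥ N, E i := by
  classical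
  have := hν.isFiniteMeasure
  obtain ⟨M, hM⟩ := hν.le_smul_volume
  set ω := volume (ball (0 : EuclideanSpace ℝ (Fin d)) 1)
  have hω : ω ≠ ∞ := volume_unitBall_ne_top
  have hC' : 0 < C' := hC.trans_lt hCC'
  obtain ⟨R, hR, hsmall⟩ := exists_forall_lt_add_mul_rpow_le (a := M * 3 ^ d * ω.toReal)
    (b := M * 3 ^ d * A) hut hud hC'
  obtain ⟨ρ, hρ, hlarge⟩ := exists_forall_le_mul_add_rpow_le hu hC hCC' hR
  have hac : ν ≪ volume := (Measure.absolutelyContinuous_of_le hM).trans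
    Measure.smul_absolutelyContinuous
  obtain ⟨J, hJ, hdisj, hmass⟩ := exists_finset_disjoint_closedBall hr hr0 hν.isOpen hcov hac
    hν.measure_compl hm hρ N
  choose! μ L K hμ hL hLE hμL hμK hμb using hP
  have hprob : ∀ i ∈ J, IsProbabilityMeasure (μ i) := fun i hi => hμ i (hJ i hi).2.1
  have hμB : ∀ i ∈ J, μ i (closedBall (c i) (r i))ᶜ = 0 := fun i hi =>
    measure_mono_null (compl_subset_compl.2 ((hLE i (hJ i hi).2.1).trans (hEB i)))
      (hμL i (hJ i hi).2.1)
  obtain ⟨U', hU'o, hLU', hU'E, hU'c⟩ := exists_open_between_and_isCompact_closure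
    (J.isCompact_biUnion fun i hi => hL i (hJ i hi).2.1)
    (isOpen_biUnion fun i (_ : i ∈ J) => hEopen i)
    (iUnion₂_mono fun i hi => hLE i (hJ i hi).2.1)
  set ν' : Measure (EuclideanSpace ℝ (Fin d)) := ∑ i ∈ J, ν (closedBall (c i) (r i)) • μ i
  have hν' : ∀ S, ν' S = ∑ i ∈ J, ν (closedBall (c i) (r i)) * μ i S := by
    intro S
    simp [ν', Measure.finsetSum_apply]
  have huniv : ν' univ = ν (⋃ i ∈ J, closedBall (c i) (r i)) := by
    rw [hν', measure_biUnion_finset hdisj fun i _ => measurableSet_closedBall]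
    refine Finset.sum_congr rfl fun i hi => ?_
    have := hprob i hi
    rw [measure_univ, mul_one]
  refine ⟨ν', U', ⟨⟨?_⟩, hU'o, ?_, ?_, ?_⟩, huniv ▸ hmass, hU'c, ?_, ?_⟩
  · rw [huniv]
    exact measure_lt_top _ _
  · rw [hν']
    refine Finset.sum_eq_zero fun i hi => ?_
    rw [measure_mono_null (compl_subset_compl.2 ((subset_biUnion_of_mem (u := L) hi).trans hLU'))
      (hμL i (hJ i hi).2.1), mul_zero]
  · refine ⟨∑ i ∈ J, (ν (closedBall (c i) (r i))).toNNReal * K i, Measure.le_iff'.2 fun S => ?_⟩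
    rw [hν', Measure.smul_apply, Finset.sum_smul]
    refine Finset.sum_le_sum fun i hi => ?_
    rw [ENNReal.smul_def, smul_eq_mul, ENNReal.coe_mul,
      ENNReal.coe_toNNReal (measure_ne_top _ _), mul_assoc]
    gcongr
    exact hμK i (hJ i hi).2.1 S
  · intro x s hs
    rw [hν']
    rcases lt_or_ge s R with hsR | hsR
    -- Small scales: the old Frostman bound is not used, only the density of `ν` and the bounds on
    -- the `μ_i`.
    · refine (sum_mul_measure_closedBall_le hr hdisj hM hprob hμB hs
        fun i hi => hμb i (hJ i hi).2.1 x s hs).trans ?_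
      refine le_trans (le_of_eq ?_) (ENNReal.ofReal_le_ofReal (hsmall s hs hsR))
      have hA' : 0 ≤ A * s ^ t := by positivity
      rw [volume_closedBall_eq x hs.le, show (M : ℝ) * 3 ^ d * ω.toReal * s ^ d +
        M * 3 ^ d * A * s ^ t = M * 3 ^ d * (s ^ d * ω.toReal + A * s ^ t) by ring,
        ENNReal.ofReal_mul (q := s ^ d * ω.toReal + A * s ^ t) (by positivity),
        ENNReal.ofReal_add (by positivity) hA', ENNReal.ofReal_mul (p := s ^ d) (by positivity),
        ENNReal.ofReal_toReal hω, ENNReal.ofReal_mul (p := (M : ℝ)) M.coe_nonneg,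
        ENNReal.ofReal_pow (p := 3) (by norm_num)]
      simp [ω]
    -- Large scales: chosen balls meeting `B_s(x)` lie in `B_{s+2ρ}(x)`, so the old bound transfers.
    · refine le_trans ?_ (ENNReal.ofReal_le_ofReal (hlarge s hsR))
      refine le_trans ?_ (hν.measure_closedBall_le x (s + 2 * ρ) (by positivity))
      set J' := J.filter fun i => (closedBall (c i) (r i) ∩ closedBall x s).Nonempty
      have hJJ' : ∑ i ∈ J', ν (closedBall (c i) (r i)) * μ i (closedBall x s) =
          ∑ i ∈ J, ν (closedBall (c i) (r i)) * μ i (closedBall x s) := by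
        refine Finset.sum_filter_of_ne fun i hi hne => ?_
        by_contra hempty
        refine hne ?_
        rw [measure_mono_null (t := (closedBall (c i) (r i))ᶜ)
          (fun y hy hyc => hempty ⟨y, hyc, hy⟩) (hμB i hi), mul_zero]
      rw [← hJJ']
      calc ∑ i ∈ J', ν (closedBall (c i) (r i)) * μ i (closedBall x s)
          ≤ ∑ i ∈ J', ν (closedBall (c i) (r i)) := by
            refine Finset.sum_le_sum fun i hi => ?_
            have := hprob i (Finset.mem_filter.1 hi).1
            exact mul_le_of_le_one_right' prob_le_one
        _ = ν (⋃ i ∈ J', closedBall (c i) (r i)) :=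
            (measure_biUnion_finset (hdisj.subset (Finset.filter_subset _ _))
              fun i _ => measurableSet_closedBall).symm
        _ ≤ ν (closedBall x (s + 2 * ρ)) := by
            refine measure_mono (iUnion₂_subset fun i hi => ?_)
            obtain ⟨hiJ, y, hyc, hyx⟩ := Finset.mem_filter.1 hi
            refine closedBall_subset_closedBall' ?_
            have h1 := (hJ i hiJ).2.2.1
            have h2 := dist_triangle_left (c i) x y
            rw [mem_closedBall] at hyc hyx
            linarith
  · exact hU'E.trans (iUnion₂_subset fun i hi => (hEB i).trans (hJ i hi).2.2.2)
  · exact hU'E.trans (iUnion₂_subset fun i hi =>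
      subset_biUnion_of_mem (u := E) (show i ∈ {i | N ≤ i} from (hJ i hi).1))

end Construction

/-! ### Mass distribution and the Hausdorff lower bound -/

section LowerBound

variable {d : ℕ}

theorem isFrostmanOn_restrict_volume {U : Set (EuclideanSpace ℝ (Fin d))} (hU : IsOpen U)
    (hb : Bornology.IsBounded U) {u : ℝ} (hu : 0 ≤ u) (hud : u ≤ d) :
    IsFrostmanOn u ((volume (ball (0 : EuclideanSpace ℝ (Fin d)) 1)).toReal + (volume U).toReal) U
      (volume.restrict U) := by
  have hUt : volume U ≠ ∞ := hb.measure_lt_top.ne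
  set ω := volume (ball (0 : EuclideanSpace ℝ (Fin d)) 1)
  have hω : ω ≠ ∞ := volume_unitBall_ne_top
  refine ⟨⟨by simpa using hUt.lt_top⟩, hU, ?_, ⟨1, by simpa using Measure.restrict_le_self⟩,
    fun x r hr => ?_⟩
  · rw [Measure.restrict_apply hU.measurableSet.compl]
    simp
  · have hru : 0 ≤ r ^ u := by positivity
    rw [add_mul, ENNReal.ofReal_add (by positivity) (by positivity),
      ENNReal.ofReal_mul ENNReal.toReal_nonneg, ENNReal.ofReal_mul ENNReal.toReal_nonneg,
      ENNReal.ofReal_toReal hω, ENNReal.ofReal_toReal hUt]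
    rcases le_total r 1 with h1 | h1
    · refine le_trans ?_ le_self_add
      calc volume.restrict U (closedBall x r) ≤ volume (closedBall x r) :=
            Measure.restrict_le_self _
        _ = ω * ENNReal.ofReal (r ^ d) := by rw [volume_closedBall_eq x hr.le, mul_comm]
        _ ≤ _ := by
            gcongr
            rw [← Real.rpow_natCast r d]
            exact Real.rpow_le_rpow_of_exponent_ge hr h1 hud
    · refine le_trans ?_ le_add_self
      calc volume.restrict U (closedBall x r) ≤ volume.restrict U univ :=
            measure_mono (subset_univ _)
        _ = volume U * 1 := by simp
        _ ≤ _ := by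
            gcongr
            exact ENNReal.one_le_ofReal.2 (Real.one_le_rpow h1 hu)

/-- A ball of radius slightly above the diameter works. It is chosen before `ν` and `C`, so one open
cover serves all stages of the construction. -/
theorem exists_isOpen_superset_measure_le {u : ℝ} (hu : 0 ≤ u)
    (S : Set (EuclideanSpace ℝ (Fin d))) (hS : ediam S ≠ ∞) {ε : ℝ≥0∞} (hε : 0 < ε) :
    ∃ V, IsOpen V ∧ S ⊆ V ∧ ∀ (C : ℝ) (U : Set (EuclideanSpace ℝ (Fin d)))
      (ν : Measure (EuclideanSpace ℝ (Fin d))), 0 ≤ C → IsFrostmanOn u C U ν →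
        ν V ≤ ENNReal.ofReal C * ((⨆ _ : S.Nonempty, ediam S ^ u) + ε) := by
  rcases S.eq_empty_or_nonempty with rfl | hne
  · exact ⟨∅, isOpen_empty, Subset.rfl, fun C U ν _ _ => by simp⟩
  obtain ⟨x, hx⟩ := hne
  have hlim : Tendsto (fun r : ℝ => ENNReal.ofReal (r ^ u)) (𝓝[>] (ediam S).toReal)
      (𝓝 (ediam S ^ u)) := by
    have h := (ENNReal.tendsto_ofReal (Real.continuousAt_rpow_const (ediam S).toReal u
      (Or.inr hu)).tendsto).mono_left (nhdsWithin_le_nhds (s := Ioi (ediam S).toReal))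
    rwa [← ENNReal.ofReal_rpow_of_nonneg ENNReal.toReal_nonneg hu,
      ENNReal.ofReal_toReal hS] at h
  have hlt : ediam S ^ u < ediam S ^ u + ε :=
    ENNReal.lt_add_right (ENNReal.rpow_ne_top_of_nonneg hu hS) hε.ne'
  obtain ⟨r, hr, hrS⟩ := ((hlim.eventually (gt_mem_nhds hlt)).and self_mem_nhdsWithin).exists
  have hrS' : (ediam S).toReal < r := hrS
  refine ⟨ball x r, isOpen_ball, fun y hy => ?_, fun C U ν hC hν => ?_⟩
  · rw [mem_ball, dist_edist]
    exact (ENNReal.toReal_mono hS (edist_le_ediam_of_mem hy hx)).trans_lt hrS'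
  · rw [iSup_pos ⟨x, hx⟩]
    calc ν (ball x r) ≤ ν (closedBall x r) := measure_mono ball_subset_closedBall
      _ ≤ ENNReal.ofReal (C * r ^ u) :=
          hν.measure_closedBall_le x r (ENNReal.toReal_nonneg.trans_lt hrS')
      _ = ENNReal.ofReal C * ENNReal.ofReal (r ^ u) := ENNReal.ofReal_mul hC
      _ ≤ _ := by gcongr

/-- Mass distribution principle along a decreasing sequence of compact sets. -/
theorem hausdorffMeasure_iInter_ne_zero {u C : ℝ} (hu : 0 ≤ u) (hC : 0 < C) {m : ℝ≥0∞}
    (hm : 0 < m) {U : ℕ → Set (EuclideanSpace ℝ (Fin d))}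
    {ν : ℕ → Measure (EuclideanSpace ℝ (Fin d))} (hν : ∀ n, IsFrostmanOn u C (U n) (ν n))
    (hmass : ∀ n, m < ν n univ) (hcompact : ∀ n, IsCompact (closure (U n)))
    (hanti : Antitone U) :
    μH[u] (⋂ n, closure (U n)) ≠ 0 := by
  intro hzero
  -- The factor 2 pays for two errors below `m / κ`: the sum over the cover and the sum of the `ε
  -- k`.
  set κ := ENNReal.ofReal C * 2
  have hκ0 : κ ≠ 0 := by simpa [κ] using hC
  have hκt : κ ≠ ∞ := ENNReal.mul_ne_top ENNReal.ofReal_ne_top (by norm_num)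
  have hη : 0 < m / κ := ENNReal.div_pos hm.ne' hκt
  rw [Measure.hausdorffMeasure_apply] at hzero
  have hone := (le_iSup₂ (f := fun (r : ℝ≥0∞) (_ : 0 < r) =>
    ⨅ (t : ℕ → Set (EuclideanSpace ℝ (Fin d))) (_ : ⋂ n, closure (U n) ⊆ ⋃ n, t n)
      (_ : ∀ n, ediam (t n) ≤ r), ∑' n, ⨆ _ : (t n).Nonempty, ediam (t n) ^ u)
    1 one_pos).trans_eq hzero
  have hlt := hone.trans_lt hη
  simp only [iInf_lt_iff] at hlt
  obtain ⟨T, hT, hTd, hTsum⟩ := hlt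
  obtain ⟨ε, hε, hεsum⟩ := ENNReal.exists_pos_sum_of_countable' hη.ne' ℕ
  choose V hVo hTV hV using fun n => exists_isOpen_superset_measure_le hu (T n)
    ((hTd n).trans_lt ENNReal.one_lt_top).ne (hε n)
  have hdir : Directed (· ⊇ ·) fun n => closure (U n) :=
    Antitone.directed_ge fun a b hab => closure_mono (hanti hab)
  -- By compactness an open cover of the intersection already covers one stage, whose own measure
  -- gives the contradiction.
  obtain ⟨n, hn⟩ := exists_subset_nhds_of_isCompact' hdir hcompact (fun _ => isClosed_closure)
    fun x hx => (isOpen_iUnion hVo).mem_nhds ((hT.trans (iUnion_mono hTV)) hx)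
  refine (hmass n).not_ge ?_
  have hUV : U n ⊆ ⋃ k, V k := subset_closure.trans hn
  calc ν n univ ≤ ν n (U n) + ν n (U n)ᶜ := by
        rw [← union_compl_self (U n)]
        exact measure_union_le _ _
    _ = ν n (U n) := by rw [(hν n).measure_compl, add_zero]
    _ ≤ ν n (⋃ k, V k) := measure_mono hUV
    _ ≤ ∑' k, ν n (V k) := measure_iUnion_le _
    _ ≤ ∑' k, ENNReal.ofReal C * ((⨆ _ : (T k).Nonempty, ediam (T k) ^ u) + ε k) :=
        ENNReal.tsum_le_tsum fun k => hV k C (U n) (ν n) hC.le (hν n)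
    _ = ENNReal.ofReal C * (∑' k, (⨆ _ : (T k).Nonempty, ediam (T k) ^ u) + ∑' k, ε k) := by
        rw [ENNReal.tsum_mul_left, ENNReal.tsum_add]
    _ ≤ ENNReal.ofReal C * (m / κ + m / κ) := by gcongr
    _ = κ * (m / κ) := by ring
    _ = m := ENNReal.mul_div_cancel hκ0 hκt

theorem IsFrostmanOn.mono {u C C' : ℝ} {U : Set (EuclideanSpace ℝ (Fin d))}
    {ν : Measure (EuclideanSpace ℝ (Fin d))} (h : IsFrostmanOn u C U ν) (hC : C ≤ C') :
    IsFrostmanOn u C' U ν where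
  isFiniteMeasure := h.isFiniteMeasure
  isOpen := h.isOpen
  measure_compl := h.measure_compl
  le_smul_volume := h.le_smul_volume
  measure_closedBall_le x r hr := (h.measure_closedBall_le x r hr).trans
    (ENNReal.ofReal_le_ofReal (by gcongr))

/-- Each refinement may worsen the constant by as little as desired, so all constants stay below `C₀
+ 1`, while every total mass stays above a fixed `m` below the volume of `U`. -/
theorem le_dimH_limsup_of_frostman {c : ℕ → EuclideanSpace ℝ (Fin d)} {r : ℕ → ℝ}
    {E : ℕ → Set (EuclideanSpace ℝ (Fin d))} (hr : ∀ i, 0 < r i) (hr0 : Tendsto r atTop (𝓝 0))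
    (hEopen : ∀ i, IsOpen (E i)) (hEB : ∀ i, E i ⊆ closedBall (c i) (r i)) {P : ℕ → Prop}
    {t A : ℝ} (hA : 0 ≤ A)
    (hP : ∀ i, P i → ∃ (ν : Measure (EuclideanSpace ℝ (Fin d)))
      (L : Set (EuclideanSpace ℝ (Fin d))) (M : ℝ≥0),
      IsProbabilityMeasure ν ∧ IsCompact L ∧ L ⊆ E i ∧ ν Lᶜ = 0 ∧ ν ≤ M • volume ∧
      ∀ x, ∀ s > 0, volume (closedBall (c i) (r i)) * ν (closedBall x s) ≤
        ENNReal.ofReal (A * s ^ t))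
    {U : Set (EuclideanSpace ℝ (Fin d))} (hU : IsOpen U) (hUne : U.Nonempty)
    (hUb : Bornology.IsBounded U)
    (hcov : ∀ᵐ x ∂volume, x ∈ U → ∃ᶠ i in atTop, P i ∧ x ∈ closedBall (c i) (r i))
    {u : ℝ≥0} (hut : u < t) (hud : (u : ℝ) < d) :
    (u : ℝ≥0∞) ≤ dimH (limsup E atTop) := by
  set C₀ := (volume (ball (0 : EuclideanSpace ℝ (Fin d)) 1)).toReal + (volume U).toReal
  have hC₀ : 0 ≤ C₀ := by positivity
  obtain ⟨m, hm0, hm⟩ := exists_between (hU.measure_pos volume hUne)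
  let Good (p : Set (EuclideanSpace ℝ (Fin d)) × Measure (EuclideanSpace ℝ (Fin d))) : Prop :=
    (∃ C, 0 ≤ C ∧ C < C₀ + 1 ∧ IsFrostmanOn u C p.1 p.2) ∧ m < p.2 univ ∧ p.1 ⊆ U
  have hstep : ∀ (N : ℕ) (p : {p // Good p}), ∃ q : {p // Good p},
      IsCompact (closure q.1.1) ∧ closure q.1.1 ⊆ p.1.1 ∧ closure q.1.1 ⊆ ⋃ i ≥ N, E i := by
    rintro N ⟨⟨W, ν⟩, ⟨C, hC0, hC, hν⟩, hmν, hWU⟩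
    obtain ⟨C', hCC', hC'⟩ := exists_between hC
    obtain ⟨ν', W', hν', hmν', hW'c, hW'W, hW'E⟩ := hν.exists_refinement hr hr0 hEopen hEB hA hP
      (hcov.mono fun x hx hxW => hx (hWU hxW)) u.coe_nonneg hut hud hC0 hCC' hmν N
    exact ⟨⟨(W', ν'), ⟨C', hC0.trans hCC'.le, hC', hν'⟩, hmν',
      subset_closure.trans (hW'W.trans hWU)⟩, hW'c, hW'W, hW'E⟩
  choose next hnext_compact hnext_sub hnext_E using hstep
  let p₀ : {p // Good p} := ⟨(U, volume.restrict U), ⟨C₀, hC₀, by linarith,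
    isFrostmanOn_restrict_volume hU hUb u.coe_nonneg hud.le⟩, by simpa using hm, Subset.rfl⟩
  let f : ℕ → {p // Good p} := fun n => Nat.rec p₀ next n
  -- The shift drops the initial stage: only refined sets come with a compact closure inside some `⋃
  -- i ≥ N, E i`.
  have hF : ∀ n, IsFrostmanOn u (C₀ + 1) (f (n + 1)).1.1 (f (n + 1)).1.2 := by
    intro n
    obtain ⟨C, -, hC, h⟩ := (f (n + 1)).2.1
    exact h.mono hC.le
  have hanti : Antitone fun n => (f (n + 1)).1.1 := antitone_nat_of_succ_le fun n =>
    subset_closure.trans (hnext_sub (n + 1) (f (n + 1)))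
  have hne := hausdorffMeasure_iInter_ne_zero u.coe_nonneg (by positivity) hm0 hF
    (fun n => (f (n + 1)).2.2.1) (fun n => hnext_compact n (f n)) hanti
  refine le_trans (le_dimH_of_hausdorffMeasure_ne_zero hne) (dimH_mono ?_)
  rw [limsup_eq_iInf_iSup_of_nat]
  exact iInter_mono fun n => hnext_E n (f n)

end LowerBound

/-! ### Full-measure limsups of balls in the cube -/

section BallCover

variable {d : ℕ}

/-- A limsup of full measure in the unit cube contains almost every point of it. -/
theorem ae_frequently_mem_of_volume_limsup_eq_one {S : ℕ → Set (EuclideanSpace ℝ (Fin d))}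
    (hS : ∀ i, MeasurableSet (S i)) (hcube : ∀ i, S i ⊆ unitCube d)
    (hfull : volume (limsup S atTop) = 1) :
    ∀ᵐ x ∂volume, x ∈ unitCube d → ∃ᶠ i in atTop, x ∈ S i := by
  have hsub : limsup S atTop ⊆ unitCube d := fun x hx =>
    let ⟨i, hi⟩ := (mem_limsup_iff_frequently_mem.1 hx).exists
    hcube i hi
  have hnull : volume (unitCube d \ limsup S atTop) = 0 := by
    rw [measure_sdiff hsub (MeasurableSet.measurableSet_limsup hS).nullMeasurableSet
      (by simp [hfull]), volume_unitCube, hfull, tsub_self]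
  filter_upwards [measure_eq_zero_iff_ae_notMem.1 hnull] with x hx hxc
  by_contra hcon
  exact hx ⟨hxc, fun h => hcon (mem_limsup_iff_frequently_mem.1 h)⟩

theorem volume_eq_volume_closedBall {c : EuclideanSpace ℝ (Fin d)} {r : ℝ} (hr : 0 < r)
    {B : Set (EuclideanSpace ℝ (Fin d))} (hB : B = ball c r ∨ B = closedBall c r) :
    volume B = volume (closedBall c r) := by
  rcases hB with rfl | rfl
  · rw [Measure.addHaar_ball_of_pos volume c hr, Measure.addHaar_closedBall volume c hr.le]
  · rfl

end BallCover

/-! ### The main theorem -/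

theorem theorem3p1 (d : ℕ)
    (c : ℕ → EuclideanSpace ℝ (Fin d)) (r : ℕ → ℝ) (B E : ℕ → Set (EuclideanSpace ℝ (Fin d)))
    (hr : ∀ i, 0 < r i) (hr0 : Tendsto r atTop (𝓝 0))
    (hB : ∀ i, B i = ball (c i) (r i) ∨ B i = closedBall (c i) (r i))
    (hcube : ∀ i, B i ⊆ unitCube d)
    (hfull : volume (limsup B atTop) = 1)
    (hEopen : ∀ i, IsOpen (E i)) (hEne : ∀ i, (E i).Nonempty) (hEB : ∀ i, E i ⊆ B i) :
    transferExponent B E ≤ dimH (limsup E atTop) ∧ packingDim (limsup E atTop) = d := by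
  have hBmeas : ∀ i, MeasurableSet (B i) := fun i => by
    rcases hB i with h | h <;> rw [h]
    exacts [measurableSet_ball, measurableSet_closedBall]
  have hBcl : ∀ i, B i ⊆ closedBall (c i) (r i) := fun i => by
    rcases hB i with h | h <;> rw [h]
    exact ball_subset_closedBall
  have hballB : ball (c 0) (r 0) ⊆ B 0 := by
    rcases hB 0 with h | h <;> rw [h]
    exact ball_subset_closedBall
  have hU : ball (c 0) (r 0) ⊆ unitCube d := hballB.trans (hcube 0)
  have hUne : (ball (c 0) (r 0)).Nonempty := nonempty_ball.2 (hr 0)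
  refine ⟨iSup₂_le fun t ht => ?_, le_antisymm (packingDim_le (isBounded_unitCube.subset ?_)) ?_⟩
  · set P : ℕ → Prop := fun i => volume (B i) ≤ singularValue t (E i)
    have hP : ∀ i, P i → ∃ (ν : Measure (EuclideanSpace ℝ (Fin d)))
        (L : Set (EuclideanSpace ℝ (Fin d))) (M : ℝ≥0),
        IsProbabilityMeasure ν ∧ IsCompact L ∧ L ⊆ E i ∧ ν Lᶜ = 0 ∧ ν ≤ M • volume ∧
        ∀ x, ∀ s > 0, volume (closedBall (c i) (r i)) * ν (closedBall x s) ≤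
          ENNReal.ofReal (4 * 2 ^ (t : ℝ) * s ^ (t : ℝ)) := by
      intro i hi
      have hi' : volume (closedBall (c i) (r i)) ≤ singularValue t (E i) :=
        (volume_eq_volume_closedBall (hr i) (hB i)).symm.trans_le hi
      obtain ⟨ν, L, M, h1, h2, h3, h4, h5, h6⟩ := exists_smooth_measure_of_le_singularValue
        (hEopen i) (measure_closedBall_pos volume _ (hr i)).ne' measure_closedBall_lt_top.ne hi'
      refine ⟨ν, L, M, h1, h2, h3, h4, h5, fun x s hs => (h6 x s hs).trans_eq ?_⟩
      rw [Real.mul_rpow (by norm_num) hs.le, mul_assoc]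
    have hS : ∀ i, {x ∈ B i | P i} ⊆ B i := fun i => sep_subset _ _
    have hfreq := ae_frequently_mem_of_volume_limsup_eq_one
      (fun i => (hBmeas i).inter (MeasurableSet.const (P i))) (fun i => (hS i).trans (hcube i)) ht
    -- A limsup of measure 1 is nonempty, so some index is selected; its Frostman measure forces `t
    -- ≤ d`, which yields `u < d` below.
    have htd : t ≤ d := by
      obtain ⟨x, hx⟩ := nonempty_of_measure_ne_zero (ht.trans_ne one_ne_zero)
      obtain ⟨i, hi⟩ := (mem_limsup_iff_frequently_mem.1 hx).exists
      obtain ⟨ν, -, -, hν, -, -, -, -, hb⟩ := hP i hi.2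
      exact le_of_frostman (measure_closedBall_pos volume (c i) (hr i)).ne'
        (C := 4 * 2 ^ (t : ℝ)) (by simpa using hb)
    refine le_of_forall_lt fun a ha => ?_
    obtain ⟨u, hau, hut⟩ := ENNReal.lt_iff_exists_nnreal_btwn.1 ha
    have hut' : u < t := by exact_mod_cast hut
    refine hau.trans_le (le_dimH_limsup_of_frostman hr hr0 hEopen
      (fun i => (hEB i).trans (hBcl i)) (by positivity) hP isOpen_ball hUne isBounded_ball
      (hfreq.mono fun x hx hxU => (hx (hU hxU)).mono fun i hi => ⟨hi.2, hBcl i hi.1⟩)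
      (by exact_mod_cast hut') (by exact_mod_cast hut'.trans_le htd))
  · intro x hx
    obtain ⟨i, hi⟩ := (mem_limsup_iff_frequently_mem.1 hx).exists
    exact hcube i (hEB i hi)
  -- Almost every point near `x` lies in arbitrarily late balls of radius below `ε / 4`, each
  -- containing a nonempty `E i`; hence the tails of `E` are dense in the first ball.
  · refine le_packingDim_of_limsup_dense hEopen isOpen_ball hUne fun n x hx => ?_
    rw [Metric.mem_closure_iff]
    intro ε hε
    have hfreq := ae_frequently_mem_of_volume_limsup_eq_one hBmeas hcube hfull
    have hopen : IsOpen (ball x (ε / 2) ∩ ball (c 0) (r 0)) := isOpen_ball.inter isOpen_ball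
    have hpos := hopen.measure_ne_zero volume ⟨x, mem_ball_self (half_pos hε), hx⟩
    obtain ⟨y, ⟨hyx, hyU⟩, hy⟩ :=
      (frequently_ae_mem_iff.2 hpos).and_eventually hfreq |>.exists
    have hsmall : ∀ᶠ i in atTop, r i < ε / 4 := hr0.eventually (gt_mem_nhds (by positivity))
    obtain ⟨i, hyi, hri, hni⟩ :=
      ((hy (hU hyU)).and_eventually (hsmall.and (eventually_ge_atTop n))).exists
    obtain ⟨e, he⟩ := hEne i
    refine ⟨e, mem_biUnion (show i ∈ {i | n ≤ i} from hni) he, ?_⟩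
    have h1 := mem_closedBall.1 (hBcl i (hEB i he))
    have h2 := mem_closedBall'.1 (hBcl i hyi)
    have h3 := mem_ball'.1 hyx
    have h4 := dist_triangle x y e
    have h5 := dist_triangle_left y e (c i)
    rw [dist_comm (c i) e, dist_comm (c i) y, dist_comm y (c i)] at h5
    linarith
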